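/- Let $\Omega\subset\mathbb R^N$ be a bounded open set, $0<\gamma_1<\gamma_0<\infty$, and let $\omega_n\subset\Omega$ ($n\in\mathbb N$) be measurable sets with $\operatorname{dist}(\omega_n,\partial\Omega)\ge d_0>0$ and $|\omega_n|\to\delta>0$. Put $\gamma_n=\gamma_1\chi_{\omega_n}+\gamma_0(1-\chi_{\omega_n})$. Let $\theta\in L^\infty(\Omega;[0,1])$ and let $\gamma^*$ be a measurable field of real symmetric $N\times N$ matrices with $\gamma_1 I\le\gamma^*(x)\le\gamma_0 I$ for a.e. $x\in\Omega$. Assume that $\chi_{\omega_n}\rightharpoonup\theta$ weakly-* in $L^\infty(\Omega)$ and that $\gamma_n I$ H-converges to $\gamma^*$ (the homogenized tensor): for every $f\in H^{-1}(\Omega)$ the solutions $u_n,u\in H^1_0(\Omega)$ of $-\operatorname{div}(\gamma_n\nabla u_n)=f$ and $-\operatorname{div}(\gamma^*\nabla u)=f$ satisfy $u_n\rightharpoonup u$ weakly in $H^1(\Omega)$ and $\gamma_n\nabla u_n\rightharpoonup\gamma^*\nabla u$ weakly in $L^2(\Omega)^N$. For $1\le i\le N$ let $w_n^i\in H^1(\Omega)$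 be the weak solution of $$-\operatorname{div}(\gamma_n\nabla w_n^i)=-\operatorname{div}(\gamma^*e_i)\ \text{ in }\Omega,\qquad w_n^i=x_i\ \text{ on }\partial\Omega,$$ where the boundary condition means $w_n^i-x_i\in H^1_0(\Omega)$. Let $M^\theta=(M^\theta_{ij})$ be a polarization tensor of $(\omega_n)$ with associated measure $\mu^\theta$; that is, $\mu^\theta$ is a finite positive Borel measure on $\overline\Omega$, $M^\theta_{ij}\in L^2(\mu^\theta)$, and along some subsequence, for all $i,j$, $$\frac1{|\omega_n|}\chi_{\omega_n}\,dx\ \overset{*}{\rightharpoonup}\ \mu^\theta,\qquad \frac1{|\omega_n|}\chi_{\omega_n}\frac{\partial w_n^i}{\partial x_j}\,dx\ \overset{*}{\rightharpoonup}\ M^\theta_{ij}\,\mu^\theta\qquad\text{weakly-* in }\bigl(C^0(\overline\Omega)\bigr)^*.$$ Then $$\theta(x)\,(\gamma_1-\gamma_0)\,M^\theta(x)=\gamma^*(x)-\gamma_0 I\qquad\text{for almost every }x\in\Omega,$$ and consequently $M^\theta(x)$ is symmetric for $\mu^\theta$-almost every $x$. -/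

import Mathlib

open Set Filter Topology MeasureTheory

noncomputable section

namespace PolTensor

/-- `A v` for a real matrix `A` and a vector `v` of Euclidean space. -/
def matVec {N : ℕ} (A : Matrix (Fin N) (Fin N) ℝ) (v : EuclideanSpace ℝ (Fin N)) :
    EuclideanSpace ℝ (Fin N) :=
  WithLp.toLp 2 (A.mulVec v.ofLp)

/-- `ψ ∈ C_c^∞(Ω)`. -/
structure IsTest {N : ℕ} (Ω : Set (EuclideanSpace ℝ (Fin N)))
    (ψ : EuclideanSpace ℝ (Fin N) → ℝ) : Prop where
  smooth : ContDiff ℝ ((⊤ : ℕ∞) : WithTop ℕ∞) ψ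
  compact : HasCompactSupport ψ
  subset : tsupport ψ ⊆ Ω

/-- `u ∈ L²(Ω)`, for `u` with values in a normed space. -/
def IsL2 {N : ℕ} {F : Type*} [NormedAddCommGroup F] (Ω : Set (EuclideanSpace ℝ (Fin N)))
    (u : EuclideanSpace ℝ (Fin N) → F) : Prop :=
  MemLp u 2 (volume.restrict Ω)

/-- `u ∈ H¹(Ω)` with weak gradient `G = ∇u ∈ L²(Ω)^N`. -/
structure IsH1 {N : ℕ} (Ω : Set (EuclideanSpace ℝ (Fin N)))
    (u : EuclideanSpace ℝ (Fin N) → ℝ)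
    (G : EuclideanSpace ℝ (Fin N) → EuclideanSpace ℝ (Fin N)) : Prop where
  memL2 : IsL2 Ω u
  grad_memL2 : IsL2 Ω G
  weak_grad : ∀ ψ : EuclideanSpace ℝ (Fin N) → ℝ, IsTest Ω ψ → ∀ i : Fin N,
    ∫ x in Ω, u x * gradient ψ x i = - ∫ x in Ω, G x i * ψ x

/-- `u ∈ H¹₀(Ω)`, the closure of `C_c^∞(Ω)` in `H¹(Ω)`, with weak gradient `G = ∇u`. -/
structure IsH10 {N : ℕ} (Ω : Set (EuclideanSpace ℝ (Fin N)))
    (u : EuclideanSpace ℝ (Fin N) → ℝ)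
    (G : EuclideanSpace ℝ (Fin N) → EuclideanSpace ℝ (Fin N)) : Prop where
  isH1 : IsH1 Ω u G
  approx : ∃ ψ : ℕ → EuclideanSpace ℝ (Fin N) → ℝ, (∀ k, IsTest Ω (ψ k)) ∧
    Tendsto (fun k => eLpNorm (fun x => ψ k x - u x) 2 (volume.restrict Ω)) atTop (𝓝 0) ∧
    Tendsto (fun k => eLpNorm (fun x => gradient (ψ k) x - G x) 2 (volume.restrict Ω))
      atTop (𝓝 0)

/-- `-div (A ∇u) = h - div g` in the sense of distributions on `Ω`, where `G = ∇u`.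
As `h` and `g` range over `L²(Ω)` and `L²(Ω)^N`, the right-hand sides range over all of
`H⁻¹(Ω)`, the dual of `H¹₀(Ω)`. -/
def WeakEq {N : ℕ} (Ω : Set (EuclideanSpace ℝ (Fin N)))
    (A : EuclideanSpace ℝ (Fin N) → Matrix (Fin N) (Fin N) ℝ)
    (h : EuclideanSpace ℝ (Fin N) → ℝ)
    (g G : EuclideanSpace ℝ (Fin N) → EuclideanSpace ℝ (Fin N)) : Prop :=
  ∀ ψ : EuclideanSpace ℝ (Fin N) → ℝ, IsTest Ω ψ →
    ∫ x in Ω, inner ℝ (matVec (A x) (G x)) (gradient ψ x) =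
      (∫ x in Ω, h x * ψ x) + ∫ x in Ω, inner ℝ (g x) (gradient ψ x)

/-- Weak convergence `v n ⇀ v` in `L²(Ω; F)`. -/
def WeakL2 {N : ℕ} {F : Type*} [NormedAddCommGroup F] [InnerProductSpace ℝ F]
    (Ω : Set (EuclideanSpace ℝ (Fin N)))
    (v : ℕ → EuclideanSpace ℝ (Fin N) → F) (v' : EuclideanSpace ℝ (Fin N) → F) : Prop :=
  ∀ φ : EuclideanSpace ℝ (Fin N) → F, IsL2 Ω φ →
    Tendsto (fun n => ∫ x in Ω, inner ℝ (v n x) (φ x)) atTop (𝓝 (∫ x in Ω, inner ℝ (v' x) (φ x)))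

/-- The class `M(a, b; Ω)`: measurable fields of real symmetric matrices `A` with
`a I ≤ A(x) ≤ b I` for almost every `x ∈ Ω`. -/
structure IsMatClass {N : ℕ} (a b : ℝ) (Ω : Set (EuclideanSpace ℝ (Fin N)))
    (A : EuclideanSpace ℝ (Fin N) → Matrix (Fin N) (Fin N) ℝ) : Prop where
  meas : ∀ i j, AEMeasurable (fun x => A x i j) (volume.restrict Ω)
  symm : ∀ᵐ x ∂(volume.restrict Ω), (A x).IsSymm
  lower : ∀ᵐ x ∂(volume.restrict Ω), (A x - a • (1 : Matrix (Fin N) (Fin N) ℝ)).PosSemidef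
  upper : ∀ᵐ x ∂(volume.restrict Ω), (b • (1 : Matrix (Fin N) (Fin N) ℝ) - A x).PosSemidef

/-- H-convergence of the symmetric, uniformly elliptic fields `A n` to `A'` on `Ω`: for every
right-hand side `f = h - div g` in `H⁻¹(Ω)`, the solutions `u n, u ∈ H¹₀(Ω)` of
`-div (A n ∇(u n)) = f` and `-div (A' ∇u) = f` satisfy `u n ⇀ u` weakly in `H¹(Ω)` and
`A n ∇(u n) ⇀ A' ∇u` weakly in `L²(Ω)^N`. -/
def HConverges {N : ℕ} (Ω : Set (EuclideanSpace ℝ (Fin N)))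
    (A : ℕ → EuclideanSpace ℝ (Fin N) → Matrix (Fin N) (Fin N) ℝ)
    (A' : EuclideanSpace ℝ (Fin N) → Matrix (Fin N) (Fin N) ℝ) : Prop :=
  ∀ (h : EuclideanSpace ℝ (Fin N) → ℝ)
    (g : EuclideanSpace ℝ (Fin N) → EuclideanSpace ℝ (Fin N)), IsL2 Ω h → IsL2 Ω g →
  ∀ (u : ℕ → EuclideanSpace ℝ (Fin N) → ℝ)
    (G : ℕ → EuclideanSpace ℝ (Fin N) → EuclideanSpace ℝ (Fin N))
    (u' : EuclideanSpace ℝ (Fin N) → ℝ)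
    (G' : EuclideanSpace ℝ (Fin N) → EuclideanSpace ℝ (Fin N)),
    (∀ n, IsH10 Ω (u n) (G n) ∧ WeakEq Ω (A n) h g (G n)) →
    IsH10 Ω u' G' ∧ WeakEq Ω A' h g G' →
    WeakL2 Ω u u' ∧ WeakL2 Ω G G' ∧
      WeakL2 Ω (fun n x => matVec (A n x) (G n x)) (fun x => matVec (A' x) (G' x))

/-- The two-phase conductivity `γ₁ χ_ω + γ₀ (1 - χ_ω)`. -/
def twoPhase {N : ℕ} (γ₀ γ₁ : ℝ) (ω : Set (EuclideanSpace ℝ (Fin N)))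
    (x : EuclideanSpace ℝ (Fin N)) : ℝ :=
  γ₁ * ω.indicator 1 x + γ₀ * (1 - ω.indicator 1 x)

/-- The isotropic field `γ(x) I`. -/
def isoField {N : ℕ} (γ : EuclideanSpace ℝ (Fin N) → ℝ) (x : EuclideanSpace ℝ (Fin N)) :
    Matrix (Fin N) (Fin N) ℝ :=
  γ x • (1 : Matrix (Fin N) (Fin N) ℝ)

/-- `χ_{ω n} ⇀ θ` weakly-* in `L^∞(Ω)`, with `θ ∈ L^∞(Ω; [0,1])`. -/
structure IsDensity {N : ℕ} (Ω : Set (EuclideanSpace ℝ (Fin N)))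
    (ω : ℕ → Set (EuclideanSpace ℝ (Fin N))) (θ : EuclideanSpace ℝ (Fin N) → ℝ) : Prop where
  meas : AEMeasurable θ (volume.restrict Ω)
  mem_Icc : ∀ᵐ x ∂(volume.restrict Ω), θ x ∈ Icc (0 : ℝ) 1
  weak_star : ∀ φ : EuclideanSpace ℝ (Fin N) → ℝ, IntegrableOn φ Ω →
    Tendsto (fun n => ∫ x in Ω, (ω n).indicator 1 x * φ x) atTop (𝓝 (∫ x in Ω, θ x * φ x))

/-- `w` with weak gradient `W` is the `i`-th oscillating test function of the field `A` with
respect to `A'`: the solution in `H¹(Ω)` of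
`-div (A ∇w) = -div (A' eᵢ)` in `Ω`, `w = xᵢ` on `∂Ω` (that is, `w - xᵢ ∈ H¹₀(Ω)`). -/
structure IsOscillating {N : ℕ} (Ω : Set (EuclideanSpace ℝ (Fin N)))
    (A A' : EuclideanSpace ℝ (Fin N) → Matrix (Fin N) (Fin N) ℝ) (i : Fin N)
    (w : EuclideanSpace ℝ (Fin N) → ℝ)
    (W : EuclideanSpace ℝ (Fin N) → EuclideanSpace ℝ (Fin N)) : Prop where
  isH1 : IsH1 Ω w W
  boundary : IsH10 Ω (fun x => w x - x i) (fun x => W x - EuclideanSpace.single i 1)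
  eq : WeakEq Ω A (fun _ => 0) (fun x => matVec (A' x) (EuclideanSpace.single i 1)) W

/-- `M` is a polarization tensor, with associated measure `μ`, of the inhomogeneities `ω n`, where
`W n i = ∇ wₙⁱ` are the gradients of the oscillating test functions: `μ` is a finite positive
Borel measure on the closure of `Ω`, `M ∈ L²(μ)` and, along some subsequence,
`|ω n|⁻¹ χ_{ω n} dx ⇀ μ` and `|ω n|⁻¹ χ_{ω n} ∂ⱼ wₙⁱ dx ⇀ Mᵢⱼ μ`
weakly-* in the dual of `C⁰(closure Ω)`. -/
structure IsPolarizationTensor {N : ℕ} (Ω : Set (EuclideanSpace ℝ (Fin N)))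
    (ω : ℕ → Set (EuclideanSpace ℝ (Fin N)))
    (W : ℕ → Fin N → EuclideanSpace ℝ (Fin N) → EuclideanSpace ℝ (Fin N))
    (μ : Measure (EuclideanSpace ℝ (Fin N)))
    (M : EuclideanSpace ℝ (Fin N) → Matrix (Fin N) (Fin N) ℝ) : Prop where
  finite : IsFiniteMeasure μ
  support : μ (closure Ω)ᶜ = 0
  memL2 : ∀ i j, MemLp (fun x => M x i j) 2 μ
  limit : ∃ s : ℕ → ℕ, StrictMono s ∧
    ∀ φ : EuclideanSpace ℝ (Fin N) → ℝ, ContinuousOn φ (closure Ω) →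
      Tendsto (fun n => (volume.real (ω (s n)))⁻¹ * ∫ x in ω (s n), φ x) atTop
        (𝓝 (∫ x in closure Ω, φ x ∂μ)) ∧
      ∀ i j, Tendsto
        (fun n => (volume.real (ω (s n)))⁻¹ * ∫ x in ω (s n), W (s n) i x j * φ x) atTop
        (𝓝 (∫ x in closure Ω, M x i j * φ x ∂μ))

end PolTensor

end

open PolTensor

/-!
The polarization measure is explicit: since `χ_{ω n} ⇀ θ` and `|ω n| → δ`, it is `δ⁻¹ θ dx` on `Ω`
(`IsPolarizationTensor.measure_eq`). So the formula for `M` follows once the weak limit of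
`χ_{ω n} ∇wₙⁱ` in `Ω` is known; formally, since
`(γ₁ - γ₀) χ_{ω n} ∇wₙⁱ = γₙ ∇wₙⁱ - γ₀ ∇wₙⁱ`, it is `(γ* - γ₀) eᵢ / (γ₁ - γ₀)`.
What has to be shown is that the fluxes `γₙ ∇wₙⁱ` and the gradients `∇wₙⁱ` have the expected limits,
although `wₙⁱ` is not in `H¹₀(Ω)` and `wₙⁱ - xᵢ` solves an equation whose right-hand side depends
on `n`, so that H-convergence does not apply to either directly. Usually this is done with the
div-curl lemma; here the symmetry of `γₙ` and the distance of `ω n` to `∂Ω` give a proof without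
any compactness.

* `∇wₙⁱ ⇀ eᵢ` by duality (`weakL2_oscillating`): testing `∇wₙⁱ - eᵢ` against `F` is the same as
  testing the gradient of the solution of `-div (γₙ ∇u) = -div F` against `γ* eᵢ`, and its flux
  against `eᵢ`. Both pass to the limit by H-convergence, and the two limits cancel.
* If `p ∈ C_c^∞(Ω)` equals `xᵢ` near all the `ω n`, then `wₙⁱ - xᵢ + p ∈ H¹₀(Ω)` solves an equation
  whose right-hand side no longer depends on `n`, because `γₙ = γ₀` wherever `∇(xᵢ - p) ≠ 0`.
  H-convergence applies to it, and its limit is `p` by the first point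
  (`weakL2_indicator_smul_oscillating`). On the set where `∇p = eᵢ`, which can be any compact
  subset of `Ω`, the limit is the expected one.

Both arguments need the solvability of the equations in `H¹₀(Ω)`. It comes from the Poincaré
inequality (`poincare`) and the Lax–Milgram theorem (`exists_solution`).
-/

noncomputable section

namespace PolTensor

/-! ### Pairings in `L²` -/

section LTwo

variable {α F : Type*} [MeasurableSpace α] {ν : Measure α} [NormedAddCommGroup F]
  [InnerProductSpace ℝ F]

theorem inner_toLp_toLp {f g : α → F} (hf : MemLp f 2 ν) (hg : MemLp g 2 ν) :
    inner ℝ (hf.toLp f) (hg.toLp g) = ∫ x, inner ℝ (f x) (g x) ∂ν := by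
  rw [L2.inner_def]
  refine integral_congr_ae ?_
  filter_upwards [hf.coeFn_toLp, hg.coeFn_toLp] with x hx hy
  rw [hx, hy]

theorem integrable_inner_of_memLp {f g : α → F} (hf : MemLp f 2 ν) (hg : MemLp g 2 ν) :
    Integrable (fun x => inner ℝ (f x) (g x)) ν := by
  refine (L2.integrable_inner (𝕜 := ℝ) (hf.toLp f) (hg.toLp g)).congr ?_
  filter_upwards [hf.coeFn_toLp, hg.coeFn_toLp] with x hx hy
  rw [hx, hy]

theorem tendsto_integral_inner {f : α → F} {g : ℕ → α → F} {g' : α → F} (hf : MemLp f 2 ν)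
    (hg : ∀ k, MemLp (g k) 2 ν) (hg' : MemLp g' 2 ν)
    (h : Tendsto (fun k => eLpNorm (fun x => g k x - g' x) 2 ν) atTop (𝓝 0)) :
    Tendsto (fun k => ∫ x, inner ℝ (f x) (g k x) ∂ν) atTop (𝓝 (∫ x, inner ℝ (f x) (g' x) ∂ν)) := by
  simp_rw [← inner_toLp_toLp hf hg', fun k => (inner_toLp_toLp hf (hg k)).symm]
  exact tendsto_const_nhds.inner ((Lp.tendsto_Lp_iff_tendsto_eLpNorm'' g hg g' hg').2 h)

theorem norm_toLp_sq {f : α → F} (hf : MemLp f 2 ν) :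
    ‖hf.toLp f‖ ^ 2 = ∫ x, ‖f x‖ ^ 2 ∂ν := by
  rw [← real_inner_self_eq_norm_sq, inner_toLp_toLp hf hf]
  simp_rw [real_inner_self_eq_norm_sq]

end LTwo

/-! ### Test functions and `H¹₀(Ω)` -/

section Test

variable {N : ℕ} {Ω : Set (EuclideanSpace ℝ (Fin N))}

theorem gradient_apply (ψ : EuclideanSpace ℝ (Fin N) → ℝ) (x : EuclideanSpace ℝ (Fin N))
    (i : Fin N) : gradient ψ x i = fderiv ℝ ψ x (EuclideanSpace.single i 1) := by
  have h : inner ℝ (gradient ψ x) (EuclideanSpace.single i 1) =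
      fderiv ℝ ψ x (EuclideanSpace.single i 1) := by
    rw [gradient, InnerProductSpace.toDual_symm_apply]
  rw [← h, EuclideanSpace.inner_single_right]
  simp

theorem gradient_add_apply {f g : EuclideanSpace ℝ (Fin N) → ℝ} {x : EuclideanSpace ℝ (Fin N)}
    (hf : DifferentiableAt ℝ f x) (hg : DifferentiableAt ℝ g x) :
    gradient (fun y => f y + g y) x = gradient f x + gradient g x := by
  ext i
  simp only [PiLp.add_apply, gradient_apply]
  rw [fderiv_fun_add hf hg]
  rfl

theorem gradient_const_mul {f : EuclideanSpace ℝ (Fin N) → ℝ} {x : EuclideanSpace ℝ (Fin N)}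
    (c : ℝ) (hf : DifferentiableAt ℝ f x) :
    gradient (fun y => c * f y) x = c • gradient f x := by
  ext i
  simp only [PiLp.smul_apply, gradient_apply]
  rw [fderiv_const_mul hf]
  rfl

theorem gradient_coord (i : Fin N) (x : EuclideanSpace ℝ (Fin N)) :
    gradient (fun y : EuclideanSpace ℝ (Fin N) => y i) x = EuclideanSpace.single i 1 := by
  ext j
  rw [gradient_apply]
  have h : fderiv ℝ (fun y : EuclideanSpace ℝ (Fin N) => y i) x = EuclideanSpace.proj i :=
    (EuclideanSpace.proj (𝕜 := ℝ) i).fderiv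
  rw [h]
  simp [eq_comm]

theorem continuous_gradient {ψ : EuclideanSpace ℝ (Fin N) → ℝ}
    (hψ : ContDiff ℝ ((⊤ : ℕ∞) : WithTop ℕ∞) ψ) : Continuous (gradient ψ) :=
  (InnerProductSpace.toDual ℝ _).symm.continuous.comp (hψ.continuous_fderiv (by simp))

namespace IsTest

variable {ψ φ : EuclideanSpace ℝ (Fin N) → ℝ}

theorem differentiable (hψ : IsTest Ω ψ) : Differentiable ℝ ψ :=
  hψ.smooth.differentiable (by simp)

theorem hasCompactSupport_gradient (hψ : IsTest Ω ψ) : HasCompactSupport (gradient ψ) :=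
  (hψ.compact.fderiv (𝕜 := ℝ)).comp_left (map_zero _)

theorem memLp (hψ : IsTest Ω ψ) : MemLp ψ 2 (volume.restrict Ω) :=
  hψ.smooth.continuous.memLp_of_hasCompactSupport hψ.compact

theorem memLp_gradient (hψ : IsTest Ω ψ) : MemLp (gradient ψ) 2 (volume.restrict Ω) :=
  (continuous_gradient hψ.smooth).memLp_of_hasCompactSupport hψ.hasCompactSupport_gradient

theorem zero : IsTest Ω (fun _ => 0) where
  smooth := contDiff_const
  compact := HasCompactSupport.zero
  subset := by simp [tsupport]

theorem add (hψ : IsTest Ω ψ) (hφ : IsTest Ω φ) : IsTest Ω (fun x => ψ x + φ x) where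
  smooth := hψ.smooth.add hφ.smooth
  compact := hψ.compact.add hφ.compact
  subset := (tsupport_add ψ φ).trans (union_subset hψ.subset hφ.subset)

theorem const_mul (c : ℝ) (hψ : IsTest Ω ψ) : IsTest Ω (fun x => c * ψ x) where
  smooth := contDiff_const.mul hψ.smooth
  compact := hψ.compact.mul_left
  subset := (tsupport_mul_subset_right (f := fun _ => c)).trans hψ.subset

theorem eq_zero (hψ : IsTest Ω ψ) {x : EuclideanSpace ℝ (Fin N)} (hx : x ∉ Ω) : ψ x = 0 :=
  image_eq_zero_of_notMem_tsupport fun h => hx (hψ.subset h)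

theorem gradient_eq_zero (hψ : IsTest Ω ψ) {x : EuclideanSpace ℝ (Fin N)} (hx : x ∉ Ω) :
    gradient ψ x = 0 := by
  have h : fderiv ℝ ψ x = 0 :=
    image_eq_zero_of_notMem_tsupport fun h => hx (hψ.subset (tsupport_fderiv_subset ℝ h))
  rw [gradient, h, map_zero]

/-- Integration by parts against a test function. -/
theorem integral_mul_gradient (hψ : IsTest Ω ψ)
    (hφ : ContDiff ℝ ((⊤ : ℕ∞) : WithTop ℕ∞) φ) (i : Fin N) :
    ∫ x in Ω, φ x * gradient ψ x i = - ∫ x in Ω, gradient φ x i * ψ x := by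
  rw [setIntegral_eq_integral_of_forall_compl_eq_zero
      (fun x hx => by simp [hψ.gradient_eq_zero hx]),
    setIntegral_eq_integral_of_forall_compl_eq_zero (fun x hx => by simp [hψ.eq_zero hx])]
  simp_rw [gradient_apply]
  have hdφ : Continuous fun x => fderiv ℝ φ x (EuclideanSpace.single i 1) :=
    (hφ.continuous_fderiv (by simp)).clm_apply continuous_const
  have hdψ : Continuous fun x => fderiv ℝ ψ x (EuclideanSpace.single i 1) :=
    (hψ.smooth.continuous_fderiv (by simp)).clm_apply continuous_const
  exact integral_mul_fderiv_eq_neg_fderiv_mul_of_integrable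
    ((hdφ.mul hψ.smooth.continuous).integrable_of_hasCompactSupport hψ.compact.mul_left)
    ((hφ.continuous.mul hdψ).integrable_of_hasCompactSupport
      (hψ.compact.fderiv_apply (𝕜 := ℝ) _).mul_left)
    ((hφ.continuous.mul hψ.smooth.continuous).integrable_of_hasCompactSupport
      hψ.compact.mul_left)
    (fun x _ => hφ.differentiable (by simp) x) (fun x _ => hψ.differentiable x)

theorem isH10 (hψ : IsTest Ω ψ) : IsH10 Ω ψ (gradient ψ) where
  isH1 := ⟨hψ.memLp, hψ.memLp_gradient, fun _ hφ i => hφ.integral_mul_gradient hψ.smooth i⟩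
  approx := ⟨fun _ => ψ, fun _ => hψ, by simp, by simp⟩

end IsTest

theorem memLp_coord {ν : Measure (EuclideanSpace ℝ (Fin N))}
    {G : EuclideanSpace ℝ (Fin N) → EuclideanSpace ℝ (Fin N)} (hG : MemLp G 2 ν) (i : Fin N) :
    MemLp (fun x => G x i) 2 ν :=
  hG.continuousLinearMap_comp (EuclideanSpace.proj (𝕜 := ℝ) i)

theorem memLp_single {ν : Measure (EuclideanSpace ℝ (Fin N))}
    {f : EuclideanSpace ℝ (Fin N) → ℝ} (hf : MemLp f 2 ν) (i : Fin N) :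
    MemLp (fun x => (EuclideanSpace.single i (f x) : EuclideanSpace ℝ (Fin N))) 2 ν := by
  refine (hf.continuousLinearMap_comp (ContinuousLinearMap.toSpanSingleton ℝ
    (EuclideanSpace.single i (1 : ℝ) : EuclideanSpace ℝ (Fin N)))).ae_eq
    (Eventually.of_forall fun x => ?_)
  ext j
  simp

/-- Limits of test functions, in `L²` together with their gradients, are in `H¹₀`: the weak
gradient of the limit is the limit of the gradients. -/
theorem isH10_of_tendsto {u : EuclideanSpace ℝ (Fin N) → ℝ}
    {G : EuclideanSpace ℝ (Fin N) → EuclideanSpace ℝ (Fin N)} (hu : IsL2 Ω u) (hG : IsL2 Ω G)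
    (ψ : ℕ → EuclideanSpace ℝ (Fin N) → ℝ) (hψ : ∀ k, IsTest Ω (ψ k))
    (h1 : Tendsto (fun k => eLpNorm (fun x => ψ k x - u x) 2 (volume.restrict Ω)) atTop (𝓝 0))
    (h2 : Tendsto (fun k => eLpNorm (fun x => gradient (ψ k) x - G x) 2 (volume.restrict Ω))
      atTop (𝓝 0)) : IsH10 Ω u G := by
  refine ⟨⟨hu, hG, fun φ hφ i => ?_⟩, ψ, hψ, h1, h2⟩
  have a1 := tendsto_integral_inner (memLp_coord hφ.memLp_gradient i) (fun k => (hψ k).memLp) hu h1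
  have a2 := tendsto_integral_inner (memLp_single hφ.memLp i) (fun k => (hψ k).memLp_gradient) hG h2
  have a3 := a2.neg
  simp only [EuclideanSpace.inner_single_left, conj_trivial] at a3
  simp only [RCLike.inner_apply, conj_trivial] at a1
  simp_rw [mul_comm (G _ i)]
  refine tendsto_nhds_unique a1 (a3.congr fun k => ?_)
  rw [hφ.integral_mul_gradient (hψ k).smooth i]
  simp_rw [mul_comm (φ _)]

theorem IsH10.add {u v : EuclideanSpace ℝ (Fin N) → ℝ}
    {G H : EuclideanSpace ℝ (Fin N) → EuclideanSpace ℝ (Fin N)} (hu : IsH10 Ω u G)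
    (hv : IsH10 Ω v H) : IsH10 Ω (fun x => u x + v x) (fun x => G x + H x) := by
  obtain ⟨ψ, hψ, p1, p2⟩ := hu.approx
  obtain ⟨φ, hφ, q1, q2⟩ := hv.approx
  refine isH10_of_tendsto (hu.isH1.memL2.add hv.isH1.memL2)
    (hu.isH1.grad_memL2.add hv.isH1.grad_memL2) (fun k x => ψ k x + φ k x)
    (fun k => (hψ k).add (hφ k)) ?_ ?_
  · refine tendsto_of_tendsto_of_tendsto_of_le_of_le tendsto_const_nhds
      (by simpa using p1.add q1) (fun _ => zero_le) fun k => ?_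
    refine le_trans (le_of_eq ?_) (eLpNorm_add_le
      ((hψ k).memLp.sub hu.isH1.memL2).aestronglyMeasurable
      ((hφ k).memLp.sub hv.isH1.memL2).aestronglyMeasurable (by norm_num))
    congr 1
    ext x
    simp only [Pi.add_apply]
    ring
  · refine tendsto_of_tendsto_of_tendsto_of_le_of_le tendsto_const_nhds
      (by simpa using p2.add q2) (fun _ => zero_le) fun k => ?_
    refine le_trans (le_of_eq ?_) (eLpNorm_add_le
      ((hψ k).memLp_gradient.sub hu.isH1.grad_memL2).aestronglyMeasurable
      ((hφ k).memLp_gradient.sub hv.isH1.grad_memL2).aestronglyMeasurable (by norm_num))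
    congr 1
    ext1 x
    simp only [Pi.add_apply]
    rw [gradient_add_apply ((hψ k).differentiable x) ((hφ k).differentiable x)]
    abel

/-- **Poincaré inequality** on a bounded set. It comes from
`∫ ψ² = -2 ∫ xᵢ ψ ∂ᵢψ` and Young's inequality. -/
theorem poincare (hΩo : IsOpen Ω) (hΩ : Bornology.IsBounded Ω) (i : Fin N) : ∃ C : ℝ, 0 ≤ C ∧
    ∀ ψ : EuclideanSpace ℝ (Fin N) → ℝ, ∀ hψ : IsTest Ω ψ,
      ‖hψ.memLp.toLp ψ‖ ≤ C * ‖hψ.memLp_gradient.toLp (gradient ψ)‖ := by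
  obtain ⟨R, hR⟩ := hΩ.exists_norm_le
  refine ⟨2 * |R|, by positivity, fun ψ hψ => ?_⟩
  have hR' : ∀ x ∈ Ω, (x i) ^ 2 ≤ |R| ^ 2 := fun x hx =>
    sq_le_sq' (neg_le_of_abs_le (((PiLp.norm_apply_le x i).trans (hR x hx)).trans (le_abs_self R)))
      ((le_abs_self _).trans (((PiLp.norm_apply_le x i).trans (hR x hx)).trans (le_abs_self R)))
  have hsq : IsTest Ω fun x => ψ x * ψ x :=
    ⟨hψ.smooth.mul hψ.smooth, hψ.compact.mul_left, tsupport_mul_subset_left.trans hψ.subset⟩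
  have hcoord : ContDiff ℝ ((⊤ : ℕ∞) : WithTop ℕ∞) fun x : EuclideanSpace ℝ (Fin N) => x i :=
    (EuclideanSpace.proj (𝕜 := ℝ) i).contDiff
  have hdiff : ∀ x, gradient (fun x => ψ x * ψ x) x i = 2 * (ψ x * gradient ψ x i) := fun x => by
    rw [gradient_apply, gradient_apply, fderiv_fun_mul (hψ.differentiable x) (hψ.differentiable x)]
    simp only [add_apply, smul_apply, smul_eq_mul]
    ring
  have key : ∫ x in Ω, ψ x ^ 2 = ∫ x in Ω, -(2 * (x i * (ψ x * gradient ψ x i))) := by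
    have h := hsq.integral_mul_gradient hcoord i
    simp only [hdiff, gradient_coord, PiLp.single_apply, if_true, one_mul] at h
    rw [integral_neg]
    simp_rw [pow_two]
    rw [← neg_eq_iff_eq_neg.2 h]
    congr 1
    refine integral_congr_ae (Eventually.of_forall fun x => ?_)
    simp only
    ring
  have i1 : Integrable (fun x => ψ x ^ 2) (volume.restrict Ω) := hψ.memLp.integrable_sq
  have i2 : Integrable (fun x => ‖gradient ψ x‖ ^ 2) (volume.restrict Ω) :=
    hψ.memLp_gradient.integrable_norm_pow (by simp)
  have i3 : Integrable (fun x => -(2 * (x i * (ψ x * gradient ψ x i)))) (volume.restrict Ω) := by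
    have hc : Continuous fun x => -(2 * (x i * (ψ x * gradient ψ x i))) := by
      have h1 := hψ.smooth.continuous
      have h2 := continuous_gradient hψ.smooth
      fun_prop
    exact (hc.integrable_of_hasCompactSupport
      (hψ.compact.mul_right.mul_left.mul_left.comp_left (g := fun t => -t) (by simp))).restrict
  have hle : ∫ x in Ω, -(2 * (x i * (ψ x * gradient ψ x i))) ≤
      ∫ x in Ω, (2⁻¹ * ψ x ^ 2 + 2 * |R| ^ 2 * ‖gradient ψ x‖ ^ 2) := by
    refine integral_mono_ae i3 ((i1.const_mul _).add (i2.const_mul _)) ?_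
    filter_upwards [ae_restrict_mem hΩo.measurableSet] with x hx
    have h1 : gradient ψ x i ^ 2 ≤ ‖gradient ψ x‖ ^ 2 :=
      sq_le_sq' (neg_le_of_abs_le (PiLp.norm_apply_le (gradient ψ x) i))
        ((le_abs_self _).trans (PiLp.norm_apply_le (gradient ψ x) i))
    have h2 := mul_le_mul (hR' x hx) h1 (sq_nonneg _) (sq_nonneg _)
    nlinarith [sq_nonneg (ψ x + 2 * (x i * gradient ψ x i))]
  rw [← key, integral_add (i1.const_mul _) (i2.const_mul _), integral_const_mul,
    integral_const_mul] at hle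
  refine le_of_abs_le (abs_le_of_sq_le_sq ?_ (by positivity))
  rw [mul_pow, mul_pow, norm_toLp_sq, norm_toLp_sq]
  simp only [Real.norm_eq_abs, sq_abs]
  simp only [sq_abs] at hle
  linarith

end Test

/-! ### Uniformly elliptic matrix fields -/

section Matrix

variable {N : ℕ}

theorem matVec_add (A : Matrix (Fin N) (Fin N) ℝ) (v w : EuclideanSpace ℝ (Fin N)) :
    matVec A (v + w) = matVec A v + matVec A w := by
  simp [matVec, Matrix.mulVec_add]

theorem matVec_sub (A : Matrix (Fin N) (Fin N) ℝ) (v w : EuclideanSpace ℝ (Fin N)) :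
    matVec A (v - w) = matVec A v - matVec A w := by
  simp [matVec, Matrix.mulVec_sub]

theorem matVec_smul (A : Matrix (Fin N) (Fin N) ℝ) (c : ℝ) (v : EuclideanSpace ℝ (Fin N)) :
    matVec A (c • v) = c • matVec A v := by
  simp [matVec, Matrix.mulVec_smul]

theorem sub_smul_one_matVec (A : Matrix (Fin N) (Fin N) ℝ) (c : ℝ)
    (v : EuclideanSpace ℝ (Fin N)) :
    matVec (A - c • (1 : Matrix (Fin N) (Fin N) ℝ)) v = matVec A v - c • v := by
  simp [matVec, Matrix.sub_mulVec, Matrix.smul_mulVec]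

theorem smul_one_sub_matVec (A : Matrix (Fin N) (Fin N) ℝ) (c : ℝ)
    (v : EuclideanSpace ℝ (Fin N)) :
    matVec (c • (1 : Matrix (Fin N) (Fin N) ℝ) - A) v = c • v - matVec A v := by
  simp [matVec, Matrix.sub_mulVec, Matrix.smul_mulVec]

theorem matVec_isoField (γ : EuclideanSpace ℝ (Fin N) → ℝ) (x v : EuclideanSpace ℝ (Fin N)) :
    matVec (isoField γ x) v = γ x • v := by
  simp [matVec, isoField, Matrix.smul_mulVec]

theorem matVec_single_apply (A : Matrix (Fin N) (Fin N) ℝ) (i j : Fin N) :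
    matVec A (EuclideanSpace.single i 1) j = A j i := by
  simp [matVec]

theorem inner_matVec_comm {A : Matrix (Fin N) (Fin N) ℝ} (hA : A.IsSymm)
    (v w : EuclideanSpace ℝ (Fin N)) : inner ℝ (matVec A v) w = inner ℝ v (matVec A w) := by
  rw [EuclideanSpace.inner_eq_star_dotProduct, EuclideanSpace.inner_eq_star_dotProduct]
  simp only [matVec, star_trivial]
  rw [Matrix.dotProduct_mulVec, ← Matrix.mulVec_transpose, hA.eq]

theorem inner_matVec_nonneg {A : Matrix (Fin N) (Fin N) ℝ} (hA : A.PosSemidef)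
    (v : EuclideanSpace ℝ (Fin N)) : 0 ≤ inner ℝ (matVec A v) v := by
  rw [EuclideanSpace.inner_eq_star_dotProduct]
  exact hA.dotProduct_mulVec_nonneg v.ofLp

/-- For a symmetric matrix `0 ≤ A ≤ b I`, the norm of `A v` is at most `b ‖v‖`: expand
`⟪A z, z⟫ ≥ 0` at `z = b v - A v`. -/
theorem norm_matVec_le {A : Matrix (Fin N) (Fin N) ℝ} {b : ℝ} (hb : 0 < b) (hA : A.IsSymm)
    (h0 : ∀ v, 0 ≤ inner ℝ (matVec A v) v) (h1 : ∀ v, inner ℝ (matVec A v) v ≤ b * ‖v‖ ^ 2)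
    (v : EuclideanSpace ℝ (Fin N)) : ‖matVec A v‖ ≤ b * ‖v‖ := by
  have hz := h0 (b • v - matVec A v)
  rw [matVec_sub, matVec_smul] at hz
  simp only [inner_sub_left, inner_sub_right, inner_smul_left, inner_smul_right,
    conj_trivial] at hz
  rw [inner_matVec_comm hA (matVec A v) v, real_inner_self_eq_norm_sq] at hz
  have h2 := h1 (matVec A v)
  have h3 := h1 v
  have h4 : b * ‖matVec A v‖ ^ 2 ≤ b * (b * inner ℝ (matVec A v) v) := by nlinarith
  have h5 := le_of_mul_le_mul_left h4 hb
  refine le_of_abs_le (abs_le_of_sq_le_sq ?_ (by positivity))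
  nlinarith

end Matrix

section Field

variable {N : ℕ} {Ω : Set (EuclideanSpace ℝ (Fin N))} {a b : ℝ}
  {A : EuclideanSpace ℝ (Fin N) → Matrix (Fin N) (Fin N) ℝ}

theorem IsMatClass.ae_le_inner (hA : IsMatClass a b Ω A) :
    ∀ᵐ x ∂volume.restrict Ω, ∀ v, a * ‖v‖ ^ 2 ≤ inner ℝ (matVec (A x) v) v := by
  filter_upwards [hA.lower] with x hx v
  have h := inner_matVec_nonneg hx v
  rw [sub_smul_one_matVec, inner_sub_left, inner_smul_left, real_inner_self_eq_norm_sq,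
    conj_trivial] at h
  linarith

theorem IsMatClass.ae_norm_le (ha : 0 ≤ a) (hb : 0 < b) (hA : IsMatClass a b Ω A) :
    ∀ᵐ x ∂volume.restrict Ω, ∀ v, ‖matVec (A x) v‖ ≤ b * ‖v‖ := by
  filter_upwards [hA.ae_le_inner, hA.upper, hA.symm] with x h1 h2 h3 v
  refine norm_matVec_le hb h3 (fun v => (by positivity : 0 ≤ a * ‖v‖ ^ 2).trans (h1 v))
    (fun v => ?_) v
  have h := inner_matVec_nonneg h2 v
  rw [smul_one_sub_matVec, inner_sub_left, inner_smul_left, real_inner_self_eq_norm_sq,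
    conj_trivial] at h
  linarith

theorem IsMatClass.memLp_matVec (ha : 0 ≤ a) (hb : 0 < b) (hA : IsMatClass a b Ω A)
    {G : EuclideanSpace ℝ (Fin N) → EuclideanSpace ℝ (Fin N)}
    (hG : MemLp G 2 (volume.restrict Ω)) :
    MemLp (fun x => matVec (A x) (G x)) 2 (volume.restrict Ω) := by
  refine hG.of_le_mul (c := b) ?_ ((hA.ae_norm_le ha hb).mono fun x hx => hx (G x))
  have h : AEMeasurable (fun x j => ∑ k, A x j k * G x k) (volume.restrict Ω) :=
    aemeasurable_pi_iff.2 fun j => Finset.aemeasurable_fun_sum _ fun k _ =>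
      (hA.meas j k).mul (memLp_coord hG k).aestronglyMeasurable.aemeasurable
  exact ((WithLp.measurable_toLp 2 _).comp_aemeasurable h).aestronglyMeasurable

theorem isMatClass_isoField_twoPhase {γ₀ γ₁ : ℝ} (hγ : γ₁ ≤ γ₀)
    {ω : Set (EuclideanSpace ℝ (Fin N))} (hω : MeasurableSet ω) :
    IsMatClass γ₁ γ₀ Ω (isoField (twoPhase γ₀ γ₁ ω)) := by
  have hbd : ∀ x, γ₁ ≤ twoPhase γ₀ γ₁ ω x ∧ twoPhase γ₀ γ₁ ω x ≤ γ₀ := fun x => by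
    by_cases hx : x ∈ ω <;> simp [twoPhase, hx, hγ]
  have hpos : ∀ c : ℝ, 0 ≤ c → (c • (1 : Matrix (Fin N) (Fin N) ℝ)).PosSemidef := fun c hc =>
    Matrix.PosSemidef.one.smul hc
  refine ⟨fun i j => ?_, ?_, ?_, ?_⟩
  · have h1 : Measurable (ω.indicator (1 : EuclideanSpace ℝ (Fin N) → ℝ)) :=
      measurable_one.indicator hω
    have h2 : Measurable (twoPhase γ₀ γ₁ ω) := by
      unfold twoPhase
      fun_prop
    simp only [isoField, Matrix.smul_apply, smul_eq_mul]
    exact (h2.mul_const _).aemeasurable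
  · exact Eventually.of_forall fun x => Matrix.isSymm_one.smul _
  · refine Eventually.of_forall fun x => ?_
    rw [isoField, ← sub_smul]
    exact hpos _ (sub_nonneg.2 (hbd x).1)
  · refine Eventually.of_forall fun x => ?_
    rw [isoField, ← sub_smul]
    exact hpos _ (sub_nonneg.2 (hbd x).2)

/-! ### Weak solutions in `H¹₀(Ω)` -/

/-- The weak formulation holds for all test functions in `H¹₀(Ω)`. -/
theorem WeakEq.integral_eq (ha : 0 ≤ a) (hb : 0 < b) (hA : IsMatClass a b Ω A)
    {g G : EuclideanSpace ℝ (Fin N) → EuclideanSpace ℝ (Fin N)} (h : WeakEq Ω A (fun _ => 0) g G)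
    (hg : MemLp g 2 (volume.restrict Ω)) (hG : MemLp G 2 (volume.restrict Ω))
    {v : EuclideanSpace ℝ (Fin N) → ℝ}
    {H : EuclideanSpace ℝ (Fin N) → EuclideanSpace ℝ (Fin N)} (hv : IsH10 Ω v H) :
    ∫ x in Ω, inner ℝ (matVec (A x) (G x)) (H x) = ∫ x in Ω, inner ℝ (g x) (H x) := by
  obtain ⟨ψ, hψ, -, h2⟩ := hv.approx
  refine tendsto_nhds_unique (tendsto_integral_inner (hA.memLp_matVec ha hb hG)
    (fun k => (hψ k).memLp_gradient) hv.isH1.grad_memL2 h2) ?_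
  refine (tendsto_integral_inner hg (fun k => (hψ k).memLp_gradient)
    hv.isH1.grad_memL2 h2).congr fun k => ?_
  rw [h (ψ k) (hψ k)]
  simp

/-- The gradients of test functions, as a subspace of `L²(Ω)^N`. -/
def testGradients (Ω : Set (EuclideanSpace ℝ (Fin N))) :
    Submodule ℝ (Lp (EuclideanSpace ℝ (Fin N)) 2 (volume.restrict Ω)) where
  carrier := {f | ∃ ψ, ∃ hψ : IsTest Ω ψ, hψ.memLp_gradient.toLp (gradient ψ) = f}
  zero_mem' := by
    refine ⟨_, IsTest.zero, ?_⟩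
    rw [← (MemLp.zero : MemLp (0 : EuclideanSpace ℝ (Fin N) → EuclideanSpace ℝ (Fin N)) 2
      (volume.restrict Ω)).toLp_zero]
    congr 1
    ext x
    simp
  add_mem' := by
    rintro _ _ ⟨ψ, hψ, rfl⟩ ⟨φ, hφ, rfl⟩
    refine ⟨_, hψ.add hφ, ?_⟩
    rw [← MemLp.toLp_add]
    congr 1
    ext1 x
    exact gradient_add_apply (hψ.differentiable x) (hφ.differentiable x)
  smul_mem' := by
    rintro c _ ⟨ψ, hψ, rfl⟩
    refine ⟨_, hψ.const_mul c, ?_⟩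
    rw [← MemLp.toLp_const_smul]
    congr 1
    ext1 x
    exact gradient_const_mul c (hψ.differentiable x)

/-- Every element of the closure of the gradients of test functions is the gradient of a function
in `H¹₀(Ω)`, by the Poincaré inequality. -/
theorem exists_isH10_of_mem_closure (hΩo : IsOpen Ω) (hΩ : Bornology.IsBounded Ω) (i : Fin N)
    {f : Lp (EuclideanSpace ℝ (Fin N)) 2 (volume.restrict Ω)}
    (hf : f ∈ (testGradients Ω).topologicalClosure) : ∃ u, IsH10 Ω u f := by
  obtain ⟨C, hC, hP⟩ := poincare (Ω := Ω) hΩo hΩ i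
  obtain ⟨s, hs, hlim⟩ := mem_closure_iff_seq_limit.1 hf
  choose ψ hψ hψs using hs
  have hcau : CauchySeq fun k => (hψ k).memLp.toLp (ψ k) := by
    rw [Metric.cauchySeq_iff']
    intro ε hε
    obtain ⟨n₀, hn₀⟩ := Metric.cauchySeq_iff'.1 hlim.cauchySeq (ε / (C + 1)) (by positivity)
    refine ⟨n₀, fun n hn => ?_⟩
    have h1 := hP _ ((hψ n).add ((hψ n₀).const_mul (-1)))
    have h2 : ((hψ n).add ((hψ n₀).const_mul (-1))).memLp.toLp _ =
        (hψ n).memLp.toLp (ψ n) - (hψ n₀).memLp.toLp (ψ n₀) := by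
      rw [← MemLp.toLp_sub]
      congr 1
      ext x
      simp [sub_eq_add_neg]
    have h3 : ((hψ n).add ((hψ n₀).const_mul (-1))).memLp_gradient.toLp _ = s n - s n₀ := by
      rw [← hψs n, ← hψs n₀, ← MemLp.toLp_sub]
      congr 1
      ext1 x
      rw [gradient_add_apply ((hψ n).differentiable x)
        (((hψ n₀).const_mul (-1)).differentiable x),
        gradient_const_mul _ ((hψ n₀).differentiable x)]
      simp [sub_eq_add_neg]
    rw [h2, h3, ← dist_eq_norm, ← dist_eq_norm] at h1
    have h4 := hn₀ n hn
    rw [lt_div_iff₀ (by positivity)] at h4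
    nlinarith [dist_nonneg (x := s n) (y := s n₀)]
  obtain ⟨u, hu⟩ := cauchySeq_tendsto_of_complete hcau
  refine ⟨u, isH10_of_tendsto (Lp.memLp u) (Lp.memLp f) ψ hψ ?_ ?_⟩
  · refine (Lp.tendsto_Lp_iff_tendsto_eLpNorm'' ψ (fun k => (hψ k).memLp) u (Lp.memLp u)).1 ?_
    rwa [Lp.toLp_coeFn]
  · refine (Lp.tendsto_Lp_iff_tendsto_eLpNorm'' (fun k => gradient (ψ k))
      (fun k => (hψ k).memLp_gradient) f (Lp.memLp f)).1 ?_
    rw [Lp.toLp_coeFn]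
    simpa only [hψs] using hlim

/-- Multiplication by a field of the class `M(a, b; Ω)`, as an operator on `L²(Ω)^N`. -/
def mulOp (ha : 0 ≤ a) (hb : 0 < b) (hA : IsMatClass a b Ω A) :
    Lp (EuclideanSpace ℝ (Fin N)) 2 (volume.restrict Ω) →L[ℝ]
      Lp (EuclideanSpace ℝ (Fin N)) 2 (volume.restrict Ω) :=
  LinearMap.mkContinuous
    { toFun := fun f => (hA.memLp_matVec ha hb (Lp.memLp f)).toLp _
      map_add' := fun f g => by
        rw [← MemLp.toLp_add]
        refine MemLp.toLp_congr _ _ ?_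
        filter_upwards [Lp.coeFn_add f g] with x hx
        simp only [hx, Pi.add_apply, matVec_add]
      map_smul' := fun c f => by
        rw [RingHom.id_apply, ← MemLp.toLp_const_smul]
        refine MemLp.toLp_congr _ _ ?_
        filter_upwards [Lp.coeFn_smul c f] with x hx
        simp only [hx, Pi.smul_apply, matVec_smul] }
    b fun f => Lp.norm_le_mul_norm_of_ae_le_mul (by
      filter_upwards [hA.ae_norm_le ha hb, (hA.memLp_matVec ha hb (Lp.memLp f)).coeFn_toLp]
        with x h1 h2
      simp only [LinearMap.coe_mk, AddHom.coe_mk]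
      rw [h2]
      exact h1 _)

theorem inner_mulOp (ha : 0 ≤ a) (hb : 0 < b) (hA : IsMatClass a b Ω A)
    (f g : Lp (EuclideanSpace ℝ (Fin N)) 2 (volume.restrict Ω)) :
    inner ℝ (mulOp ha hb hA f) g = ∫ x in Ω, inner ℝ (matVec (A x) (f x)) (g x) := by
  conv_lhs => rw [← Lp.toLp_coeFn g (Lp.memLp g)]
  exact inner_toLp_toLp (hA.memLp_matVec ha hb (Lp.memLp f)) (Lp.memLp g)

/-- Existence of the solution in `H¹₀(Ω)` of `-div (A ∇u) = -div g`, by the Lax–Milgram theorem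
on the closure of the gradients of test functions. -/
theorem exists_solution (hΩo : IsOpen Ω) (hΩ : Bornology.IsBounded Ω) (i : Fin N) (ha : 0 < a)
    (hb : 0 < b) (hA : IsMatClass a b Ω A)
    {g : EuclideanSpace ℝ (Fin N) → EuclideanSpace ℝ (Fin N)}
    (hg : MemLp g 2 (volume.restrict Ω)) :
    ∃ u G, IsH10 Ω u G ∧ WeakEq Ω A (fun _ => 0) g G := by
  set V := (testGradients Ω).topologicalClosure
  have : CompleteSpace V := (testGradients Ω).isClosed_topologicalClosure.completeSpace_coe
  set T := mulOp ha.le hb hA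
  let B : V →L[ℝ] V →L[ℝ] ℝ := (innerSL ℝ).comp (V.orthogonalProjectionOnto.comp (T.comp V.subtypeL))
  have hB : ∀ v w : V, B v w = inner ℝ (T v) (w : Lp _ 2 (volume.restrict Ω)) := fun v w => by
    simp [B]
  have hco : IsCoercive B := by
    refine ⟨a, ha, fun v => ?_⟩
    rw [hB, inner_mulOp]
    have h1 : ‖v‖ * ‖v‖ =
        ∫ x in Ω, ‖(v : Lp (EuclideanSpace ℝ (Fin N)) 2 (volume.restrict Ω)) x‖ ^ 2 := by
      rw [← norm_toLp_sq (Lp.memLp _), Lp.toLp_coeFn, ← pow_two]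
      rfl
    rw [mul_assoc, h1, ← integral_const_mul]
    refine integral_mono_ae (((Lp.memLp _).integrable_norm_pow (by simp)).const_mul _)
      (integrable_inner_of_memLp (hA.memLp_matVec ha.le hb (Lp.memLp _)) (Lp.memLp _)) ?_
    exact hA.ae_le_inner.mono fun x hx => hx _
  obtain ⟨v, hv⟩ := hco.continuousLinearEquivOfBilin.surjective
    (V.orthogonalProjectionOnto (hg.toLp g))
  obtain ⟨u, hu⟩ := exists_isH10_of_mem_closure hΩo hΩ i v.2
  refine ⟨u, _, hu, fun ψ hψ => ?_⟩
  let p : V := ⟨hψ.memLp_gradient.toLp (gradient ψ),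
    (testGradients Ω).le_topologicalClosure ⟨ψ, hψ, rfl⟩⟩
  have h1 := hco.continuousLinearEquivOfBilin_apply v p
  rw [hv, hB, Submodule.inner_orthogonalProjectionOnto_eq_of_mem_right] at h1
  have h2 : inner ℝ (T v) (p : Lp _ 2 (volume.restrict Ω)) =
      ∫ x in Ω, inner ℝ
        (matVec (A x) ((v : Lp (EuclideanSpace ℝ (Fin N)) 2 (volume.restrict Ω)) x))
        (gradient ψ x) :=
    inner_toLp_toLp (hA.memLp_matVec ha.le hb (Lp.memLp _)) hψ.memLp_gradient
  rw [← h2, ← h1]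
  simpa using inner_toLp_toLp hg hψ.memLp_gradient

end Field

/-! ### Convergence of the oscillating test functions -/

section Homogenization

variable {N : ℕ} {Ω : Set (EuclideanSpace ℝ (Fin N))}

theorem memLp_const_of_isBounded (hΩ : Bornology.IsBounded Ω) (c : EuclideanSpace ℝ (Fin N)) :
    MemLp (fun _ : EuclideanSpace ℝ (Fin N) => c) 2 (volume.restrict Ω) := by
  have : IsFiniteMeasure (volume.restrict Ω) := ⟨by simpa using hΩ.measure_lt_top⟩
  exact memLp_const c

/-- The gradients of the oscillating test functions converge weakly to `eᵢ`. By symmetry of `A n`,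
testing `W n - eᵢ` against `F` amounts to testing the fixed right-hand side `A' eᵢ` and the
constant `eᵢ` against the gradient and the flux of the solution of `-div (A n ∇u) = -div F`,
to which H-convergence applies. -/
theorem weakL2_oscillating (hΩo : IsOpen Ω) (hΩ : Bornology.IsBounded Ω) {a b : ℝ} (ha : 0 < a)
    (hb : 0 < b) {A : ℕ → EuclideanSpace ℝ (Fin N) → Matrix (Fin N) (Fin N) ℝ}
    {A' : EuclideanSpace ℝ (Fin N) → Matrix (Fin N) (Fin N) ℝ}
    (hA : ∀ n, IsMatClass a b Ω (A n)) (hA' : IsMatClass a b Ω A') (hH : HConverges Ω A A')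
    (i : Fin N) {w : ℕ → EuclideanSpace ℝ (Fin N) → ℝ}
    {W : ℕ → EuclideanSpace ℝ (Fin N) → EuclideanSpace ℝ (Fin N)}
    (hw : ∀ n, IsOscillating Ω (A n) A' i (w n) (W n)) :
    WeakL2 Ω W (fun _ => EuclideanSpace.single i 1) := by
  intro F hF
  have he := memLp_const_of_isBounded hΩ (EuclideanSpace.single i (1 : ℝ))
  have hae := hA'.memLp_matVec ha.le hb he
  choose u U hu hU using fun n => exists_solution hΩo hΩ i ha hb (hA n) hF
  obtain ⟨u', U', hu', hU'⟩ := exists_solution hΩo hΩ i ha hb hA' hF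
  obtain ⟨-, hconv, hflux⟩ := hH (fun _ => 0) F MemLp.zero hF u U u' U'
    (fun n => ⟨hu n, hU n⟩) ⟨hu', hU'⟩
  have h1 := (hconv _ hae).sub (hflux _ he)
  have hlim : ∫ x in Ω, inner ℝ (U' x) (matVec (A' x) (EuclideanSpace.single i 1)) =
      ∫ x in Ω, inner ℝ (matVec (A' x) (U' x)) (EuclideanSpace.single i 1) := by
    refine integral_congr_ae ?_
    filter_upwards [hA'.symm] with x hx
    rw [inner_matVec_comm hx]
  rw [hlim, sub_self] at h1
  have h2 := h1.add_const (∫ x in Ω, inner ℝ (EuclideanSpace.single i 1) (F x))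
  rw [zero_add] at h2
  refine h2.congr fun n => ?_
  have hWn : MemLp (W n) 2 (volume.restrict Ω) := (hw n).isH1.grad_memL2
  have hUn : MemLp (U n) 2 (volume.restrict Ω) := (hu n).isH1.grad_memL2
  have hAU := (hA n).memLp_matVec ha.le hb hUn
  have e1 := (hU n).integral_eq ha.le hb (hA n) hF hUn (hw n).boundary
  have e2 := (hw n).eq.integral_eq ha.le hb (hA n) hae hWn (hu n)
  have e3 : ∫ x in Ω, inner ℝ (matVec (A n x) (W n x)) (U n x) =
      ∫ x in Ω, inner ℝ (matVec (A n x) (U n x)) (W n x) := by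
    refine integral_congr_ae ?_
    filter_upwards [(hA n).symm] with x hx
    rw [inner_matVec_comm hx, real_inner_comm]
  simp only [inner_sub_right] at e1
  rw [integral_sub (integrable_inner_of_memLp hAU hWn) (integrable_inner_of_memLp hAU he),
    integral_sub (integrable_inner_of_memLp hF hWn) (integrable_inner_of_memLp hF he)] at e1
  have hcomm : ∀ f g : EuclideanSpace ℝ (Fin N) → EuclideanSpace ℝ (Fin N),
      ∫ x in Ω, inner ℝ (f x) (g x) = ∫ x in Ω, inner ℝ (g x) (f x) := fun f g =>
    integral_congr_ae (Eventually.of_forall fun x => real_inner_comm _ _)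
  rw [hcomm F (W n), hcomm F] at e1
  rw [hcomm (U n)]
  linarith

/-- A test function equal to `1` near a given compact subset of `Ω`. -/
theorem exists_isTest_eq_one (hΩo : IsOpen Ω)
    {K : Set (EuclideanSpace ℝ (Fin N))} (hK : IsCompact K) (hKΩ : K ⊆ Ω) :
    ∃ η, IsTest Ω η ∧ ∀ᶠ x in 𝓝ˢ K, η x = 1 := by
  obtain ⟨L, hL, hKL, hLΩ⟩ := exists_compact_between hK hΩo hKΩ
  obtain ⟨η, h1, h0, -⟩ := exists_contMDiffMap_one_nhds_of_subset_interior
    (n := (⊤ : ℕ∞)) (modelWithCornersSelf ℝ (EuclideanSpace ℝ (Fin N)))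
    hK.isClosed hKL
  have hsub : tsupport η ⊆ L :=
    closure_minimal (fun x hx => by_contra fun h => hx (h0 x h)) hL.isClosed
  exact ⟨η, ⟨η.contMDiff.contDiff, hL.of_isClosed_subset (isClosed_tsupport _) hsub,
    hsub.trans hLΩ⟩, h1⟩

theorem twoPhase_sub {γ₀ γ₁ : ℝ} (ω : Set (EuclideanSpace ℝ (Fin N)))
    (x : EuclideanSpace ℝ (Fin N)) :
    twoPhase γ₀ γ₁ ω x - γ₀ = (γ₁ - γ₀) * ω.indicator 1 x := by
  rw [twoPhase]
  ring

/-- If `p ∈ C_c^∞(Ω)` has gradient `eᵢ` on all the inhomogeneities, then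
`(γ₁ - γ₀) χ_{ω n} ∇wₙⁱ ⇀ (γ* - γ₀) ∇p` weakly in `L²(Ω)`. Indeed `y n = wₙⁱ - xᵢ + p` is in
`H¹₀(Ω)` and, since `γₙ = γ₀` wherever `∇p ≠ eᵢ`, it solves an equation whose right-hand side
`-div (γ* eᵢ - γ₀ (eᵢ - ∇p))` does not depend on `n`. So H-convergence applies to it, and its
limit is `p`. -/
theorem weakL2_indicator_smul_oscillating (hΩo : IsOpen Ω) (hΩ : Bornology.IsBounded Ω)
    {γ₀ γ₁ : ℝ} (hγ₁ : 0 < γ₁) (hγ : γ₁ < γ₀) {ω : ℕ → Set (EuclideanSpace ℝ (Fin N))}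
    (hω_meas : ∀ n, MeasurableSet (ω n))
    {γs : EuclideanSpace ℝ (Fin N) → Matrix (Fin N) (Fin N) ℝ} (hγs : IsMatClass γ₁ γ₀ Ω γs)
    (hH : HConverges Ω (fun n => isoField (twoPhase γ₀ γ₁ (ω n))) γs) (i : Fin N)
    {w : ℕ → EuclideanSpace ℝ (Fin N) → ℝ}
    {W : ℕ → EuclideanSpace ℝ (Fin N) → EuclideanSpace ℝ (Fin N)}
    (hw : ∀ n, IsOscillating Ω (isoField (twoPhase γ₀ γ₁ (ω n))) γs i (w n) (W n))
    {p : EuclideanSpace ℝ (Fin N) → ℝ} (hp : IsTest Ω p)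
    (hpω : ∀ n, ∀ x ∈ ω n, gradient p x = EuclideanSpace.single i 1) :
    WeakL2 Ω (fun n x => ((γ₁ - γ₀) * (ω n).indicator 1 x) • W n x)
      (fun x => matVec (γs x) (gradient p x) - γ₀ • gradient p x) := by
  have hγ₀ : 0 < γ₀ := hγ₁.trans hγ
  have hA : ∀ n, IsMatClass γ₁ γ₀ Ω (isoField (twoPhase γ₀ γ₁ (ω n))) := fun n =>
    isMatClass_isoField_twoPhase hγ.le (hω_meas n)
  set e : EuclideanSpace ℝ (Fin N) := EuclideanSpace.single i 1 with he_def
  have he := memLp_const_of_isBounded hΩ e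
  have hP := hp.memLp_gradient
  have hW : ∀ n, MemLp (W n) 2 (volume.restrict Ω) := fun n => (hw n).isH1.grad_memL2
  have hγe := hγs.memLp_matVec hγ₁.le hγ₀ he
  have hq : MemLp (fun x => γ₀ • (e - gradient p x)) 2 (volume.restrict Ω) :=
    (he.sub hP).const_smul γ₀
  have hg : MemLp (fun x => matVec (γs x) e - γ₀ • (e - gradient p x)) 2 (volume.restrict Ω) :=
    hγe.sub hq
  have hy := fun n => (hw n).boundary.add hp.isH10
  have hYL : ∀ n, MemLp (fun x => W n x - e + gradient p x) 2 (volume.restrict Ω) :=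
    fun n => (hy n).isH1.grad_memL2
  have hy_eq : ∀ n, WeakEq Ω (isoField (twoPhase γ₀ γ₁ (ω n))) (fun _ => 0)
      (fun x => matVec (γs x) e - γ₀ • (e - gradient p x))
      (fun x => W n x - e + gradient p x) := by
    intro n ψ hψ
    have hflux : ∀ x, matVec (isoField (twoPhase γ₀ γ₁ (ω n)) x) (W n x - e + gradient p x) =
        matVec (isoField (twoPhase γ₀ γ₁ (ω n)) x) (W n x) - γ₀ • (e - gradient p x) := by
      intro x
      simp only [matVec_isoField]
      by_cases hx : x ∈ ω n
      · simp [hpω n x hx]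
      · have : twoPhase γ₀ γ₁ (ω n) x = γ₀ := by simp [twoPhase, hx]
        rw [this]
        module
    have h := (hw n).eq ψ hψ
    simp only [hflux, inner_sub_left, ← he_def] at h ⊢
    rw [integral_sub (integrable_inner_of_memLp ((hA n).memLp_matVec hγ₁.le hγ₀ (hW n))
        hψ.memLp_gradient) (integrable_inner_of_memLp hq hψ.memLp_gradient), h,
      integral_sub (integrable_inner_of_memLp hγe hψ.memLp_gradient)
        (integrable_inner_of_memLp hq hψ.memLp_gradient)]
    ring
  obtain ⟨y, Y, hyY, hY_eq⟩ := exists_solution hΩo hΩ i hγ₁ hγ₀ hγs hg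
  have hYm : MemLp Y 2 (volume.restrict Ω) := hyY.isH1.grad_memL2
  obtain ⟨-, hconv, hflux⟩ := hH (fun _ => 0) _ MemLp.zero hg _ _ y Y
    (fun n => ⟨hy n, hy_eq n⟩) ⟨hyY, hY_eq⟩
  have hWe := weakL2_oscillating hΩo hΩ hγ₁ hγ₀ hA hγs hH i hw
  -- uniqueness of weak limits gives `Y = ∇p`
  have hYP : ∀ F, IsL2 Ω F → ∫ x in Ω, inner ℝ (Y x) (F x) =
      ∫ x in Ω, inner ℝ (gradient p x) (F x) := by
    intro F hF
    refine tendsto_nhds_unique (hconv F hF) ?_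
    have h := ((hWe F hF).sub_const (∫ x in Ω, inner ℝ e (F x))).add_const
      (∫ x in Ω, inner ℝ (gradient p x) (F x))
    rw [sub_self, zero_add] at h
    refine h.congr fun n => ?_
    have hWF := integrable_inner_of_memLp ((hW n).sub he) hF
    simp only [Pi.sub_apply, inner_sub_left] at hWF
    rw [← integral_sub (integrable_inner_of_memLp (hW n) hF) (integrable_inner_of_memLp he hF),
      ← integral_add hWF (integrable_inner_of_memLp hP hF)]
    simp only [inner_add_left, inner_sub_left, he_def]
  have hYae : Y =ᵐ[volume.restrict Ω] gradient p := by
    have h := hYP _ (hYm.sub hP)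
    rw [← sub_eq_zero, ← integral_sub (integrable_inner_of_memLp hYm (hYm.sub hP))
      (integrable_inner_of_memLp hP (hYm.sub hP))] at h
    simp_rw [← inner_sub_left, Pi.sub_apply, real_inner_self_eq_norm_sq] at h
    have h0 := (integral_eq_zero_iff_of_nonneg (fun x => by positivity)
      ((hYm.sub hP).integrable_norm_pow (by simp))).1 h
    filter_upwards [h0] with x hx
    simpa [sub_eq_zero] using hx
  intro F hF
  have hlim := (hflux F hF).sub ((hconv F hF).const_mul γ₀)
  have hend : (∫ x in Ω, inner ℝ (matVec (γs x) (Y x)) (F x)) -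
        γ₀ * ∫ x in Ω, inner ℝ (Y x) (F x) =
      ∫ x in Ω, inner ℝ (matVec (γs x) (gradient p x) - γ₀ • gradient p x) (F x) := by
    rw [← integral_const_mul, ← integral_sub
      (integrable_inner_of_memLp (hγs.memLp_matVec hγ₁.le hγ₀ hYm) hF)
      ((integrable_inner_of_memLp hYm hF).const_mul γ₀)]
    refine integral_congr_ae ?_
    filter_upwards [hYae] with x hx
    rw [hx, inner_sub_left, inner_smul_left, conj_trivial]
  rw [hend] at hlim
  refine hlim.congr fun n => ?_
  rw [← integral_const_mul, ← integral_sub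
    (integrable_inner_of_memLp ((hA n).memLp_matVec hγ₁.le hγ₀ (hYL n)) hF)
    ((integrable_inner_of_memLp (hYL n) hF).const_mul γ₀)]
  refine integral_congr_ae (Eventually.of_forall fun x => ?_)
  simp only [matVec_isoField, inner_smul_left, conj_trivial]
  rw [← sub_mul, twoPhase_sub]
  by_cases hx : x ∈ ω n
  · rw [hpω n x hx, sub_add_cancel]
  · simp [hx]

end Homogenization

/-! ### The polarization measure and tensor -/

section Polarization

variable {N : ℕ} {Ω : Set (EuclideanSpace ℝ (Fin N))} {ω : ℕ → Set (EuclideanSpace ℝ (Fin N))}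
  {θ : EuclideanSpace ℝ (Fin N) → ℝ} {δ : ℝ}
  {W : ℕ → Fin N → EuclideanSpace ℝ (Fin N) → EuclideanSpace ℝ (Fin N)}
  {μ : Measure (EuclideanSpace ℝ (Fin N))}
  {M : EuclideanSpace ℝ (Fin N) → Matrix (Fin N) (Fin N) ℝ}

theorem setIntegral_indicator_one_mul {s : Set (EuclideanSpace ℝ (Fin N))} (hs : MeasurableSet s)
    (hsub : s ⊆ Ω) (f : EuclideanSpace ℝ (Fin N) → ℝ) :
    ∫ x in Ω, s.indicator 1 x * f x = ∫ x in s, f x := by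
  have h : (fun x => s.indicator 1 x * f x) = s.indicator f := by
    ext x
    by_cases hx : x ∈ s <;> simp [hx]
  rw [h, integral_indicator hs, Measure.restrict_restrict hs, inter_eq_left.2 hsub]

theorem IsDensity.aemeasurable_ofReal (hθ : IsDensity Ω ω θ) (c : ℝ) :
    AEMeasurable (fun x => ENNReal.ofReal (c * θ x)) (volume.restrict Ω) :=
  (hθ.meas.const_mul c).ennreal_ofReal

theorem IsDensity.integrable_mul (hθ : IsDensity Ω ω θ) {f : EuclideanSpace ℝ (Fin N) → ℝ}
    (hf : IntegrableOn f Ω) : IntegrableOn (fun x => θ x * f x) Ω := by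
  refine hf.bdd_mul (c := 1) hθ.meas.aestronglyMeasurable ?_
  filter_upwards [hθ.mem_Icc] with x hx
  rw [Real.norm_eq_abs, abs_of_nonneg hx.1]
  exact hx.2

theorem integral_withDensity_density (hδ : 0 < δ) (hθ : IsDensity Ω ω θ)
    (f : EuclideanSpace ℝ (Fin N) → ℝ) :
    ∫ x, f x ∂(volume.restrict Ω).withDensity (fun x => ENNReal.ofReal (δ⁻¹ * θ x)) =
      δ⁻¹ * ∫ x in Ω, θ x * f x := by
  rw [integral_withDensity_eq_integral_toReal_smul₀ (hθ.aemeasurable_ofReal _)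
    (Eventually.of_forall fun _ => ENNReal.ofReal_lt_top), ← integral_const_mul]
  refine integral_congr_ae ?_
  filter_upwards [hθ.mem_Icc] with x hx
  rw [ENNReal.toReal_ofReal (mul_nonneg (inv_nonneg.2 hδ.le) hx.1), smul_eq_mul, mul_assoc]

/-- The measure associated with a polarization tensor is `δ⁻¹ θ dx` on `Ω`. -/
theorem IsPolarizationTensor.measure_eq (hM : IsPolarizationTensor Ω ω W μ M)
    (hΩ : Bornology.IsBounded Ω)
    (hω_meas : ∀ n, MeasurableSet (ω n)) (hω_sub : ∀ n, ω n ⊆ Ω) (hδ : 0 < δ)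
    (hω_vol : Tendsto (fun n => volume.real (ω n)) atTop (𝓝 δ)) (hθ : IsDensity Ω ω θ) :
    μ = (volume.restrict Ω).withDensity (fun x => ENNReal.ofReal (δ⁻¹ * θ x)) := by
  have : IsFiniteMeasure μ := hM.finite
  have : IsFiniteMeasure (volume.restrict Ω) := ⟨by simpa using hΩ.measure_lt_top⟩
  have hint : ∀ f : BoundedContinuousFunction (EuclideanSpace ℝ (Fin N)) ℝ, IntegrableOn f Ω :=
    fun f => f.integrable _
  have : IsFiniteMeasure
      ((volume.restrict Ω).withDensity (fun x => ENNReal.ofReal (δ⁻¹ * θ x))) := by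
    refine isFiniteMeasure_withDensity_ofReal ?_
    have h := hθ.integrable_mul (f := fun _ => 1) (integrable_const 1)
    simp only [mul_one] at h
    exact (h.const_mul _).2
  refine ext_of_forall_integral_eq_of_IsFiniteMeasure fun f => ?_
  rw [integral_withDensity_density hδ hθ]
  obtain ⟨s, hs, hlim⟩ := hM.limit
  have h1 := (hlim f f.continuous.continuousOn).1
  rw [Measure.restrict_eq_self_of_ae_mem (show ∀ᵐ x ∂μ, x ∈ closure Ω from hM.support)] at h1
  refine tendsto_nhds_unique h1 ?_
  refine ((hω_vol.comp hs.tendsto_atTop).inv₀ hδ.ne').mul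
    (((hθ.weak_star f (hint f)).comp hs.tendsto_atTop).congr fun n => ?_)
  exact setIntegral_indicator_one_mul (hω_meas _) (hω_sub _) f

/-- The points of the closure of `Ω` at distance at least `d` from its boundary form a compact
subset of `Ω`. -/
theorem isCompact_and_subset_of_le_dist_frontier (hΩo : IsOpen Ω) (hΩ : Bornology.IsBounded Ω)
    {d : ℝ} (hd : 0 < d) :
    IsCompact {x ∈ closure Ω | ∀ y ∈ frontier Ω, d ≤ dist x y} ∧
      {x ∈ closure Ω | ∀ y ∈ frontier Ω, d ≤ dist x y} ⊆ Ω := by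
  refine ⟨?_, fun x hx => by_contra fun h => ?_⟩
  · refine Metric.isCompact_of_isClosed_isBounded ?_ (hΩ.closure.subset fun x hx => hx.1)
    have : {x ∈ closure Ω | ∀ y ∈ frontier Ω, d ≤ dist x y} =
        closure Ω ∩ ⋂ y ∈ frontier Ω, {x | d ≤ dist x y} := by
      ext x
      simp
    rw [this]
    exact isClosed_closure.inter (isClosed_biInter fun y _ =>
      isClosed_le continuous_const (continuous_id.dist continuous_const))
  · have hfr : x ∈ frontier Ω := by
      rw [hΩo.frontier_eq]
      exact ⟨hx.1, h⟩
    have := hx.2 x hfr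
    rw [dist_self] at this
    linarith

/-- The limit of `(γ₁ - γ₀) χ_{ω n} ∂ⱼ wₙⁱ` against a test function `φ`. The hypothesis on the distance
of the inhomogeneities to the boundary provides the cutoff needed for H-convergence, which is
taken to be `1` on the support of `φ` as well. -/
theorem tendsto_integral_indicator_mul_oscillating (hΩo : IsOpen Ω)
    (hΩ : Bornology.IsBounded Ω) {γ₀ γ₁ : ℝ} (hγ₁ : 0 < γ₁) (hγ : γ₁ < γ₀)
    (hω_meas : ∀ n, MeasurableSet (ω n)) (hω_sub : ∀ n, ω n ⊆ Ω) {d₀ : ℝ} (hd₀ : 0 < d₀)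
    (hω_dist : ∀ n, ∀ x ∈ ω n, ∀ y ∈ frontier Ω, d₀ ≤ dist x y)
    {γs : EuclideanSpace ℝ (Fin N) → Matrix (Fin N) (Fin N) ℝ} (hγs : IsMatClass γ₁ γ₀ Ω γs)
    (hH : HConverges Ω (fun n => isoField (twoPhase γ₀ γ₁ (ω n))) γs) (i : Fin N)
    {w : ℕ → EuclideanSpace ℝ (Fin N) → ℝ}
    {W : ℕ → EuclideanSpace ℝ (Fin N) → EuclideanSpace ℝ (Fin N)}
    (hw : ∀ n, IsOscillating Ω (isoField (twoPhase γ₀ γ₁ (ω n))) γs i (w n) (W n)) (j : Fin N)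
    {φ : EuclideanSpace ℝ (Fin N) → ℝ} (hφ : IsTest Ω φ) :
    Tendsto (fun n => (γ₁ - γ₀) * ∫ x in ω n, W n x j * φ x) atTop
      (𝓝 (∫ x in Ω, φ x * (γs x j i - γ₀ * (1 : Matrix (Fin N) (Fin N) ℝ) j i))) := by
  -- a cutoff of the coordinate `xᵢ`, with gradient `eᵢ` on every `ω n` and on the support
  -- of `φ`
  obtain ⟨hK, hKΩ⟩ := isCompact_and_subset_of_le_dist_frontier hΩo hΩ hd₀
  obtain ⟨η, hη, hη1⟩ := exists_isTest_eq_one hΩo (hK.union hφ.compact)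
    (union_subset hKΩ hφ.subset)
  have hcoord : ContDiff ℝ ((⊤ : ℕ∞) : WithTop ℕ∞) fun x : EuclideanSpace ℝ (Fin N) => x i :=
    (EuclideanSpace.proj (𝕜 := ℝ) i).contDiff
  have hp : IsTest Ω fun x => η x * x i :=
    ⟨hη.smooth.mul hcoord, hη.compact.mul_right, tsupport_mul_subset_left.trans hη.subset⟩
  have hgrad : ∀ x ∈ {x ∈ closure Ω | ∀ y ∈ frontier Ω, d₀ ≤ dist x y} ∪ tsupport φ,
      gradient (fun x => η x * x i) x = EuclideanSpace.single i 1 := by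
    intro x hx
    rw [← gradient_coord i x]
    refine Filter.EventuallyEq.gradient_eq ?_
    filter_upwards [eventually_nhdsSet_iff_forall.1 hη1 x hx] with y hy
    rw [hy, one_mul]
  have hweak := weakL2_indicator_smul_oscillating hΩo hΩ hγ₁ hγ hω_meas hγs hH i
    hw hp (fun n x hx => hgrad x
      (Or.inl ⟨subset_closure (hω_sub n hx), hω_dist n x hx⟩)) _ (memLp_single hφ.memLp j)
  have hright : ∫ x in Ω, inner ℝ
      (matVec (γs x) (gradient (fun x => η x * x i) x) -
        γ₀ • gradient (fun x => η x * x i) x) (EuclideanSpace.single j (φ x)) =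
      ∫ x in Ω, φ x * (γs x j i - γ₀ * (1 : Matrix (Fin N) (Fin N) ℝ) j i) := by
    refine integral_congr_ae (Eventually.of_forall fun x => ?_)
    simp only [EuclideanSpace.inner_single_right, conj_trivial]
    by_cases hx : x ∈ tsupport φ
    · rw [hgrad x (Or.inr hx)]
      simp [matVec_single_apply, Matrix.one_apply]
    · simp [image_eq_zero_of_notMem_tsupport hx]
  rw [hright] at hweak
  refine hweak.congr fun n => ?_
  rw [← setIntegral_indicator_one_mul (hω_meas _) (hω_sub _), ← integral_const_mul]
  refine integral_congr_ae (Eventually.of_forall fun x => ?_)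
  simp only [EuclideanSpace.inner_single_right, conj_trivial, PiLp.smul_apply, smul_eq_mul]
  ring

end Polarization
end PolTensor

end

open PolTensor
theorem proposition2p3 (N : ℕ) (Ω : Set (EuclideanSpace ℝ (Fin N)))
    (hΩ_open : IsOpen Ω) (hΩ_bdd : Bornology.IsBounded Ω)
    (γ₀ γ₁ : ℝ) (hγ₁ : 0 < γ₁) (hγ : γ₁ < γ₀)
    -- the inhomogeneities, at a positive distance from the boundary
    (ω : ℕ → Set (EuclideanSpace ℝ (Fin N)))
    (hω_meas : ∀ n, MeasurableSet (ω n)) (hω_sub : ∀ n, ω n ⊆ Ω)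
    (d₀ : ℝ) (hd₀ : 0 < d₀)
    (hω_dist : ∀ n, ∀ x ∈ ω n, ∀ y ∈ frontier Ω, d₀ ≤ dist x y)
    (δ : ℝ) (hδ : 0 < δ) (hω_vol : Tendsto (fun n => volume.real (ω n)) atTop (𝓝 δ))
    -- the density and the homogenized tensor
    (θ : EuclideanSpace ℝ (Fin N) → ℝ) (hθ : IsDensity Ω ω θ)
    (γs : EuclideanSpace ℝ (Fin N) → Matrix (Fin N) (Fin N) ℝ)
    (hγs : IsMatClass γ₁ γ₀ Ω γs)
    (hH : HConverges Ω (fun n => isoField (twoPhase γ₀ γ₁ (ω n))) γs)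
    -- the oscillating test functions and their gradients
    (w : ℕ → Fin N → EuclideanSpace ℝ (Fin N) → ℝ)
    (W : ℕ → Fin N → EuclideanSpace ℝ (Fin N) → EuclideanSpace ℝ (Fin N))
    (hw : ∀ n i, IsOscillating Ω (isoField (twoPhase γ₀ γ₁ (ω n))) γs i (w n i) (W n i))
    -- the polarization tensor and its measure
    (μ : Measure (EuclideanSpace ℝ (Fin N)))
    (M : EuclideanSpace ℝ (Fin N) → Matrix (Fin N) (Fin N) ℝ)
    (hM : IsPolarizationTensor Ω ω W μ M) :
    (∀ᵐ x ∂(volume.restrict Ω),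
      (θ x * (γ₁ - γ₀)) • M x = γs x - γ₀ • (1 : Matrix (Fin N) (Fin N) ℝ)) ∧
    (∀ᵐ x ∂μ, (M x).IsSymm) := by
  have : IsFiniteMeasure μ := hM.finite
  have : IsFiniteMeasure (volume.restrict Ω) := ⟨by simpa using hΩ_bdd.measure_lt_top⟩
  have hμ := hM.measure_eq hΩ_bdd hω_meas hω_sub hδ hω_vol hθ
  have hmain : ∀ᵐ x ∂(volume.restrict Ω),
      (θ x * (γ₁ - γ₀)) • M x = γs x - γ₀ • (1 : Matrix (Fin N) (Fin N) ℝ) := by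
    -- the limit of the `j`-th component of `∇wₙⁱ` is the entry `(j, i)` of `γ*`; the symmetry of
    -- `γ*` restores the order of the indices at the end
    have hcomp : ∀ i j, ∀ᵐ x ∂(volume.restrict Ω),
        θ x * (γ₁ - γ₀) * M x i j - (γs x j i - γ₀ * (1 : Matrix (Fin N) (Fin N) ℝ) j i) = 0 := by
      intro i j
      have he := memLp_const_of_isBounded hΩ_bdd (EuclideanSpace.single i (1 : ℝ))
      have hγi : IntegrableOn (fun x => γs x j i) Ω := by
        have h := (memLp_coord (hγs.memLp_matVec hγ₁.le (hγ₁.trans hγ) he) j).integrable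
          (by norm_num)
        simp only [matVec_single_apply] at h
        exact h
      have hMint : IntegrableOn (fun x => θ x * M x i j) Ω := by
        have h := (hM.memL2 i j).integrable (by norm_num)
        rw [hμ, integrable_withDensity_iff_integrable_smul₀' (hθ.aemeasurable_ofReal _)
          (Eventually.of_forall fun _ => ENNReal.ofReal_lt_top)] at h
        refine (h.const_mul δ).congr ?_
        filter_upwards [hθ.mem_Icc] with x hx
        rw [ENNReal.toReal_ofReal (mul_nonneg (inv_nonneg.2 hδ.le) hx.1), smul_eq_mul]
        field_simp
      have hLint : IntegrableOn (fun x => θ x * (γ₁ - γ₀) * M x i j) Ω := by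
        refine (hMint.const_mul (γ₁ - γ₀)).congr (Eventually.of_forall fun x => ?_)
        simp only
        ring
      have hRint : IntegrableOn
          (fun x => γs x j i - γ₀ * (1 : Matrix (Fin N) (Fin N) ℝ) j i) Ω :=
        hγi.sub (integrable_const _)
      refine (ae_restrict_iff' hΩ_open.measurableSet).2
        (hΩ_open.ae_eq_zero_of_integral_contDiff_smul_eq_zero
          (hLint.sub hRint).locallyIntegrableOn fun φ hφ hφc hφs => ?_)
      have hφT : IsTest Ω φ := ⟨hφ, hφc, hφs⟩
      have hlimφ := tendsto_integral_indicator_mul_oscillating hΩ_open hΩ_bdd hγ₁ hγ hω_meas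
        hω_sub hd₀ hω_dist hγs hH i (fun n => hw n i) j hφT
      obtain ⟨s, hs, hlim⟩ := hM.limit
      have hl := (hlim φ hφ.continuous.continuousOn).2 i j
      rw [Measure.restrict_eq_self_of_ae_mem
        (show ∀ᵐ x ∂μ, x ∈ closure Ω from hM.support), hμ,
        integral_withDensity_density hδ hθ] at hl
      have hl2 := ((hω_vol.comp hs.tendsto_atTop).mul hl).mul_const (γ₁ - γ₀)
      have heq : ∫ x in Ω, φ x * (γs x j i - γ₀ * (1 : Matrix (Fin N) (Fin N) ℝ) j i) =
          δ * (δ⁻¹ * ∫ x in Ω, θ x * (M x i j * φ x)) * (γ₁ - γ₀) := by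
        refine tendsto_nhds_unique (hlimφ.comp hs.tendsto_atTop) (hl2.congr' ?_)
        filter_upwards [(hω_vol.comp hs.tendsto_atTop).eventually_ne hδ.ne'] with n hn
        simp only [Function.comp_apply] at hn ⊢
        rw [mul_inv_cancel_left₀ hn, mul_comm]
      rw [mul_inv_cancel_left₀ hδ.ne', ← integral_mul_const] at heq
      rw [← setIntegral_eq_integral_of_forall_compl_eq_zero (s := Ω)
        (fun x hx => by simp [hφT.eq_zero hx])]
      simp only [smul_eq_mul, mul_sub (φ _) (θ _ * _ * _)]
      have hcφ : Continuous φ := hφ.continuous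
      obtain ⟨C, hC⟩ := hφc.exists_bound_of_continuous hcφ
      rw [integral_sub (hLint.bdd_mul hcφ.aestronglyMeasurable (Eventually.of_forall hC))
        (hRint.bdd_mul hcφ.aestronglyMeasurable (Eventually.of_forall hC)), heq, sub_eq_zero]
      refine integral_congr_ae (Eventually.of_forall fun x => ?_)
      simp only
      ring
    have hall : ∀ᵐ x ∂(volume.restrict Ω), ∀ i j,
        θ x * (γ₁ - γ₀) * M x i j - (γs x j i - γ₀ * (1 : Matrix (Fin N) (Fin N) ℝ) j i) = 0 :=
      ae_all_iff.2 fun i => ae_all_iff.2 fun j => hcomp i j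
    filter_upwards [hall, hγs.symm] with x hx hsymm
    ext i j
    have h := sub_eq_zero.1 (hx i j)
    rw [hsymm.apply, Matrix.isSymm_one.apply] at h
    simpa using h
  refine ⟨hmain, ?_⟩
  rw [hμ, ae_withDensity_iff' (hθ.aemeasurable_ofReal _)]
  filter_upwards [hmain, hγs.symm] with x hx hsymm hne
  have hθx : θ x * (γ₁ - γ₀) ≠ 0 := by
    refine mul_ne_zero (fun h => hne (by simp [h])) (sub_ne_zero.2 hγ.ne)
  have hS : ((θ x * (γ₁ - γ₀)) • M x).IsSymm := by
    rw [hx]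
    exact hsymm.sub (Matrix.isSymm_one.smul _)
  have hMx : M x = (θ x * (γ₁ - γ₀))⁻¹ • ((θ x * (γ₁ - γ₀)) • M x) := by
    rw [smul_smul, inv_mul_cancel₀ hθx, one_smul]
  rw [hMx]
  exact hS.smul _
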